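/- Let $d$ be a natural number and let $F:\mathbb{R}^d\to\mathbb{R}^d$ be a map of class $C^1$ with $F(x)\neq 0$ for every $x\in\mathbb{R}^d$. Suppose that $F$ is cyclically quasi-monotone, i.e. for every $N\ge 1$ and all points $x_0,\dots,x_N\in\mathbb{R}^d$ with $x_N=x_0$, $$\min_{0\le i<N}\,(x_{i+1}-x_i)\cdot F(x_i)\le 0 .$$ Then there is a lower semicontinuous function $f:\mathbb{R}^d\to\mathbb{R}$ that is quasi-convex (that is, $\{x: f(x)\le \ell\}$ is convex for every $\ell\in\mathbb{R}$) and satisfies $$F(x)\in N_f(x)\quad\text{for every }x\in\mathbb{R}^d,$$ where $N_f(x)=\{p\in\mathbb{R}^d : p\cdot(w-x)\le 0\ \text{for every } w\in\mathbb{R}^d \text{ with } f(w)\le f(x)\}$ is the normal cone at $x$ to the sublevel set $\{w : f(w)\le f(x)\}$. -/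

import Mathlib

namespace QuasiMonotone

/-- A multi-map `F : ℝ^d ⊸ ℝ^d` is cyclically quasi-monotone if for every cycle
`x 0, …, x N = x 0` (with `N ≥ 1`) and all `p i ∈ F (x i)`, `i < N`, one has
`min_{0 ≤ i < N} (x (i+1) - x i) · p i ≤ 0`, i.e. one of these scalar products is `≤ 0`.
Only the values of `x` on `{0, …, N}` and of `p` on `{0, …, N-1}` matter. -/
def CyclicallyQuasiMonotone {d : ℕ}
    (F : EuclideanSpace ℝ (Fin d) → Set (EuclideanSpace ℝ (Fin d))) : Prop :=
  ∀ (N : ℕ) (x p : ℕ → EuclideanSpace ℝ (Fin d)), 1 ≤ N → x N = x 0 →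
    (∀ i < N, p i ∈ F (x i)) → ∃ i < N, inner ℝ (x (i + 1) - x i) (p i) ≤ 0

/-- The normal cone `N_C(x)` to a set `C` at `x` (the subdifferential at `x` of the convex
indicator of `C`; in particular it is empty when `x ∉ C`). -/
def normalCone {d : ℕ} (C : Set (EuclideanSpace ℝ (Fin d))) (x : EuclideanSpace ℝ (Fin d)) :
    Set (EuclideanSpace ℝ (Fin d)) :=
  {p | x ∈ C ∧ ∀ w ∈ C, inner ℝ p (w - x) ≤ 0}

/-- The normal cone multi-map `N_f` of a function `f : ℝ^d → ℝ`: the normal cone at `x` to the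
sublevel set `{w | f w ≤ f x}`. -/
def normalConeMap {d : ℕ} (f : EuclideanSpace ℝ (Fin d) → ℝ) (x : EuclideanSpace ℝ (Fin d)) :
    Set (EuclideanSpace ℝ (Fin d)) :=
  normalCone {w | f w ≤ f x} x

end QuasiMonotone

open Filter Topology Relation Metric
open scoped RealInnerProductSpace

namespace QuasiMonotone

/-! ### Geometry of the reachable sets. -/

variable {E : Type*} [NormedAddCommGroup E] [InnerProductSpace ℝ E]

/-! Cyclic quasi-monotonicity says that no chain of strictly forward moves returns to its start. If
f increases strictly along such moves, then F x is normal to the sublevel set at x. Take f = ∑ 2⁻ⁿ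
1_{reach(qₙ)} with (qₙ) dense. Each reachable set is open with convex complement; sums of
quasi-convex functions can fail to be quasi-convex, but here reachable sets that meet are nested
(`reach_subset_or_subset`).

Nestedness rests on `mem_closure_reach_symm`: from a boundary point p of `reach F y`, chains come
back arbitrarily close to y. Along that boundary F is normal to the convex complement, so a chain
from y, projected to the boundary and reversed, never goes backward; `mem_closure_reach_of_path`
tilts it into strict moves, using C¹ through local Lipschitz bounds. -/

/-- `y` lies strictly on the side of `x` to which `F x` points. -/
def Ahead (F : E → E) (x y : E) : Prop := 0 < ⟪y - x, F x⟫

/-- The points which can be reached from `x` by a chain of moves, each strictly forward. -/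
def reach (F : E → E) (x : E) : Set E := {y | TransGen (Ahead F) x y}

variable {F : E → E} {x y z w : E}

lemma isOpen_reach (F : E → E) (x : E) : IsOpen (reach F x) := by
  have h : reach F x = ⋃ z ∈ {z | ReflTransGen (Ahead F) x z}, {w | Ahead F z w} := by
    ext w
    simp [reach, TransGen.tail'_iff]
  rw [h]
  refine isOpen_biUnion fun z _ => ?_
  exact isOpen_lt continuous_const (by fun_prop)

lemma Ahead.of_combo {u v : E} {a b : ℝ} (ha : 0 ≤ a) (hb : 0 ≤ b) (hab : a + b = 1)
    (h : Ahead F z (a • u + b • v)) : Ahead F z u ∨ Ahead F z v := by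
  unfold Ahead at *
  by_contra! hc
  have e : a • u + b • v - z = a • (u - z) + b • (v - z) := by
    rw [smul_sub, smul_sub, sub_add_sub_comm, ← add_smul, hab, one_smul]
  rw [e, inner_add_left, real_inner_smul_left, real_inner_smul_left] at h
  nlinarith [mul_nonpos_of_nonneg_of_nonpos ha hc.1, mul_nonpos_of_nonneg_of_nonpos hb hc.2]

lemma reach_of_combo {u v : E} {a b : ℝ} (ha : 0 ≤ a) (hb : 0 ≤ b) (hab : a + b = 1)
    (h : a • u + b • v ∈ reach F x) : u ∈ reach F x ∨ v ∈ reach F x := by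
  obtain ⟨z, hz, hzw⟩ := TransGen.tail'_iff.1 h
  exact (hzw.of_combo ha hb hab).imp (TransGen.tail' hz) (TransGen.tail' hz)

lemma convex_compl_reach (F : E → E) (x : E) : Convex ℝ (reach F x)ᶜ := by
  intro u hu v hv a b ha hb hab h
  exact (reach_of_combo ha hb hab h).elim hu hv

/-- The first move from z is an open condition on its starting point, so it is also available from
points of `reach F x` near z. -/
lemma reach_subset_of_mem_closure (hF : Continuous F) (hz : z ∈ closure (reach F x)) :
    reach F z ⊆ reach F x := by
  intro w hw
  obtain ⟨z₁, h₁, h₂⟩ := TransGen.head'_iff.1 hw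
  have ho : IsOpen {z' | Ahead F z' z₁} := isOpen_lt continuous_const (by fun_prop)
  obtain ⟨z', hz', hxz'⟩ := mem_closure_iff.1 hz _ ho h₁
  exact (TransGen.tail hxz' hz').trans_left h₂

lemma ahead_add_smul (hne : F y ≠ 0) {t : ℝ} (ht : 0 < t) : Ahead F y (y + t • F y) := by
  unfold Ahead
  rw [add_sub_cancel_left, real_inner_smul_left]
  exact mul_pos ht (real_inner_self_pos.2 hne)

lemma mem_closure_reach_self (hne : F y ≠ 0) : y ∈ closure (reach F y) := by
  have ht : Tendsto (fun t : ℝ => y + t • F y) (𝓝[>] 0) (𝓝 y) := by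
    have : Tendsto (fun t : ℝ => y + t • F y) (𝓝 0) (𝓝 (y + (0 : ℝ) • F y)) :=
      Continuous.tendsto (by fun_prop) 0
    rw [zero_smul, add_zero] at this
    exact this.mono_left nhdsWithin_le_nhds
  refine mem_closure_of_tendsto ht ?_
  filter_upwards [self_mem_nhdsWithin] with t h
  exact TransGen.single (ahead_add_smul hne h)

lemma inner_nonpos_of_mem_closure (hF : Continuous F) (hz : z ∈ closure (reach F y))
    (hw : w ∉ reach F y) : ⟪w - z, F z⟫ ≤ 0 := by
  by_contra! h
  exact hw (reach_subset_of_mem_closure hF hz (TransGen.single h))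

/-! ### Following a path that never goes backward -/

/-- Here a, b are points of the path, A, B the values of F there, and C its value at the shifted
point a + δA. The gain (δ' - δ)⟪B, C⟫ ≥ Lhδm/2 beats the errors 2KℓMhδ + Kℓ²h². -/
lemma inner_perturbed_pos {a b A B C : E} {δ δ' h ℓ K M L m : ℝ} (hδ : 0 < δ) (hh : 0 < h)
    (hℓ : 0 ≤ ℓ) (hK : 0 ≤ K) (hM : 0 ≤ M) (hL : 0 ≤ L)
    (hab : ‖b - a‖ ≤ ℓ * h) (hB : 0 ≤ ⟪b - a, B⟫) (hBM : ‖B‖ ≤ M) (hCM : ‖C‖ ≤ M)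
    (hBA : ‖B - A‖ ≤ K * ℓ * h) (hCA : ‖C - A‖ ≤ K * M * δ) (hδ' : L * h * δ ≤ δ' - δ)
    (hm : m ≤ ‖B‖ ^ 2) (h₁ : K * ℓ * M * h ≤ m / 4) (h₂ : K * M ^ 2 * δ ≤ m / 4)
    (hLm : 2 * (K * ℓ * M) + 1 ≤ L * (m / 2)) (h₃ : K * ℓ ^ 2 * h < δ) :
    0 < ⟪b + δ' • B - (a + δ • A), C⟫ := by
  have hCB : ‖C - B‖ ≤ K * M * δ + K * ℓ * h := by
    calc ‖C - B‖ = ‖(C - A) - (B - A)‖ := by congr 1; abel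
      _ ≤ _ := (norm_sub_le _ _).trans (add_le_add hCA hBA)
  have e₁ : -(ℓ * h * (K * M * δ + K * ℓ * h)) ≤ ⟪b - a, C⟫ := by
    have h1 : ⟪b - a, C⟫ = ⟪b - a, B⟫ + ⟪b - a, C - B⟫ := by rw [← inner_add_right]; congr 1; abel
    have h2 := (abs_le.1 (abs_real_inner_le_norm (b - a) (C - B))).1
    have h3 := mul_le_mul hab hCB (norm_nonneg _) (by positivity)
    linarith
  have e₂ : m / 2 ≤ ⟪B, C⟫ := by
    have h1 : ⟪B, C⟫ = ‖B‖ ^ 2 + ⟪B, C - B⟫ := by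
      rw [← real_inner_self_eq_norm_sq, ← inner_add_right]; congr 1; abel
    have h2 := (abs_le.1 (abs_real_inner_le_norm B (C - B))).1
    have h3 := mul_le_mul hBM hCB (norm_nonneg _) hM
    nlinarith
  have e₃ : -(K * ℓ * h * M) ≤ ⟪B - A, C⟫ := by
    have h2 := (abs_le.1 (abs_real_inner_le_norm (B - A) C)).1
    have h3 := mul_le_mul hBA hCM (norm_nonneg _) (by positivity)
    linarith
  have e : ⟪b + δ' • B - (a + δ • A), C⟫ = ⟪b - a, C⟫ + (δ' - δ) * ⟪B, C⟫ + δ * ⟪B - A, C⟫ := by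
    rw [← real_inner_smul_left, ← real_inner_smul_left, ← inner_add_left, ← inner_add_left]
    congr 1
    module
  have hm0 : 0 ≤ m / 2 := by
    have : 0 ≤ K * ℓ * M * h := by positivity
    linarith
  have e₄ : L * h * δ * (m / 2) ≤ (δ' - δ) * ⟪B, C⟫ :=
    mul_le_mul hδ' e₂ hm0 (le_trans (by positivity) hδ')
  have e₅ := mul_le_mul_of_nonneg_left e₃ hδ.le
  have e₆ := mul_le_mul_of_nonneg_left hLm (mul_pos hh hδ).le
  have e₇ := mul_lt_mul_of_pos_left h₃ hh
  rw [e]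
  nlinarith

lemma eventually_mul_lt (A : ℝ) {c : ℝ} (hc : 0 < c) : ∀ᶠ ε in 𝓝[>] (0 : ℝ), A * ε < c := by
  have h : Tendsto (fun ε : ℝ => A * ε) (𝓝[>] 0) (𝓝 (A * 0)) :=
    (Continuous.tendsto (by fun_prop) 0).mono_left nhdsWithin_le_nhds
  rw [mul_zero] at h
  exact h.eventually_lt_const hc

lemma mem_reach_of_small_steps {η : ℝ → E} {h₀ : ℝ} (h₀pos : 0 < h₀)
    (hη : ∀ s t, 0 ≤ s → s < t → t ≤ 1 → t - s < h₀ → Ahead F (η s) (η t)) :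
    η 1 ∈ reach F (η 0) := by
  obtain ⟨N, hN⟩ := exists_nat_one_div_lt h₀pos
  have hN0 : (0 : ℝ) < N + 1 := by positivity
  have key : ∀ k : ℕ, k + 1 ≤ N + 1 → η ((k + 1 : ℕ) / (N + 1)) ∈ reach F (η 0) := by
    have hstep : ∀ k : ℕ, k + 1 ≤ N + 1 → Ahead F (η (k / (N + 1))) (η ((k + 1 : ℕ) / (N + 1))) := by
      intro k hk
      have hk' : ((k + 1 : ℕ) : ℝ) ≤ N + 1 := by exact_mod_cast hk
      refine hη _ _ (by positivity) (by gcongr; simp) ((div_le_one hN0).2 hk') ?_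
      rwa [← sub_div, Nat.cast_add, Nat.cast_one, add_sub_cancel_left]
    intro k
    induction k with
    | zero => intro hk; exact TransGen.single (by simpa using hstep 0 hk)
    | succ k ih => intro hk; exact (ih (by omega)).tail (hstep (k + 1) hk)
  have := key N le_rfl
  rwa [Nat.cast_add, Nat.cast_one, div_self hN0.ne'] at this

lemma mem_closure_reach_of_path [ProperSpace E] (hF : ContDiff ℝ 1 F) (hne : ∀ x, F x ≠ 0)
    {ζ : ℝ → E} {ℓ : ℝ} (hℓ : 0 ≤ ℓ)
    (hLip : ∀ s t, 0 ≤ s → s ≤ t → t ≤ 1 → ‖ζ t - ζ s‖ ≤ ℓ * (t - s))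
    (hfwd : ∀ s t, 0 ≤ s → s ≤ t → t ≤ 1 → 0 ≤ ⟪ζ t - ζ s, F (ζ t)⟫) :
    ζ 1 ∈ closure (reach F (ζ 0)) := by
  set S := closedBall (ζ 0) (ℓ + 1) with hS
  have hSc : IsCompact S := isCompact_closedBall _ _
  obtain ⟨K, hK⟩ :=
    (hF.locallyLipschitz.locallyLipschitzOn (s := S)).exists_lipschitzOnWith_of_compact hSc
  obtain ⟨M, hM⟩ := hSc.exists_bound_of_continuousOn hF.continuous.continuousOn
  have h0S : ζ 0 ∈ S := mem_closedBall_self (by linarith)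
  have hM0 : 0 ≤ M := (norm_nonneg _).trans (hM _ h0S)
  obtain ⟨x₀, -, hx₀⟩ := hSc.exists_isMinOn ⟨_, h0S⟩ hF.continuous.norm.continuousOn
  set m := ‖F x₀‖ ^ 2 with hm
  have hmpos : 0 < m := by have := norm_pos_iff.2 (hne x₀); positivity
  have hmin : ∀ x ∈ S, m ≤ ‖F x‖ ^ 2 := fun x hx => by
    exact pow_le_pow_left₀ (norm_nonneg _) (hx₀ hx) 2
  -- The +1 leaves a surplus hδ that absorbs the second-order error Kℓ²h².
  set L := (2 * (K * ℓ * M) + 1) / (m / 2) with hL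
  have hL0 : 0 ≤ L := by positivity
  have hLm : 2 * (K * ℓ * M) + 1 ≤ L * (m / 2) := by rw [hL, div_mul_cancel₀ _ (by positivity)]
  rw [Metric.mem_closure_iff]
  intro r hr
  -- In turn: F varies little under the shift, the shifted path stays in S, and it ends within r of
  -- ζ 1. The step bound h₀ is then chosen depending on ε.
  obtain ⟨ε, ⟨⟨hε₁, hε₂⟩, hε₃⟩, hε⟩ := ((((eventually_mul_lt (K * M ^ 2 * Real.exp L)
    (show 0 < m / 4 by positivity)).and (eventually_mul_lt (M * Real.exp L) one_pos)).and
    (eventually_mul_lt (M * Real.exp L) hr)).and self_mem_nhdsWithin).exists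
  have hε : 0 < ε := hε
  obtain ⟨h₀, ⟨hh₁, hh₂⟩, hh₀⟩ := (((eventually_mul_lt (K * ℓ * M) (show 0 < m / 4 by positivity)).and
    (eventually_mul_lt (K * ℓ ^ 2) hε)).and self_mem_nhdsWithin).exists
  have hh₀ : 0 < h₀ := hh₀
  set η : ℝ → E := fun t => ζ t + (ε * Real.exp (L * t)) • F (ζ t) with hη
  have hζS : ∀ t, 0 ≤ t → t ≤ 1 → ‖ζ t - ζ 0‖ ≤ ℓ := fun t h0 h1 => by
    have := hLip 0 t le_rfl h0 h1
    nlinarith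
  have hζS' : ∀ t, 0 ≤ t → t ≤ 1 → ζ t ∈ S := fun t h0 h1 => by
    rw [hS, mem_closedBall_iff_norm]
    linarith [hζS t h0 h1]
  have hexp : ∀ t, t ≤ 1 → ε * Real.exp (L * t) ≤ ε * Real.exp L := fun t h1 => by
    have : L * t ≤ L := by nlinarith
    gcongr
  have hdisp : ∀ t, 0 ≤ t → t ≤ 1 → ‖η t - ζ t‖ ≤ M * Real.exp L * ε := fun t h0 h1 => by
    rw [hη, add_sub_cancel_left, norm_smul, Real.norm_of_nonneg (by positivity)]
    have := mul_le_mul (hexp t h1) (hM _ (hζS' t h0 h1)) (norm_nonneg _) (by positivity)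
    linarith
  have hηS : ∀ t, 0 ≤ t → t ≤ 1 → η t ∈ S := fun t h0 h1 => by
    rw [hS, mem_closedBall_iff_norm]
    have := norm_add_le (η t - ζ t) (ζ t - ζ 0)
    rw [sub_add_sub_cancel] at this
    linarith [hζS t h0 h1, hdisp t h0 h1]
  have hFlip : ∀ u ∈ S, ∀ v ∈ S, ‖F u - F v‖ ≤ K * ‖u - v‖ := fun u hu v hv =>
    hK.norm_sub_le hu hv
  have hreach : η 1 ∈ reach F (η 0) := by
    refine mem_reach_of_small_steps hh₀ fun s t h0 hst h1 hsmall => ?_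
    have hts : 0 < t - s := sub_pos.2 hst
    have hs1 : s ≤ 1 := hst.le.trans h1
    have ht0 : 0 ≤ t := h0.trans hst.le
    have hδ := hexp s hs1
    have hab := hLip s t h0 hst.le h1
    refine inner_perturbed_pos (δ := ε * Real.exp (L * s)) (h := t - s) (ℓ := ℓ) (K := K)
      (M := M) (L := L) (m := m) (by positivity) hts hℓ K.2 hM0 hL0 hab (hfwd s t h0 hst.le h1)
      (hM _ (hζS' t ht0 h1)) (hM _ (hηS s h0 hs1)) ?_ ?_ ?_ (hmin _ (hζS' t ht0 h1)) ?_ ?_ hLm ?_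
    · refine (hFlip _ (hζS' t ht0 h1) _ (hζS' s h0 hs1)).trans ?_
      rw [mul_assoc]
      gcongr
    · refine (hFlip _ (hηS s h0 hs1) _ (hζS' s h0 hs1)).trans ?_
      rw [mul_assoc]
      gcongr
      rw [hη, add_sub_cancel_left, norm_smul, Real.norm_of_nonneg (by positivity), mul_comm]
      gcongr
      exact hM _ (hζS' s h0 hs1)
    · have h2 : Real.exp (L * t) = Real.exp (L * s) * Real.exp (L * (t - s)) := by
        rw [← Real.exp_add]; ring_nf
      have h3 := Real.add_one_le_exp (L * (t - s))
      have h4 := mul_le_mul_of_nonneg_left h3 (show 0 ≤ ε * Real.exp (L * s) by positivity)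
      rw [h2]
      linarith
    · have : K * ℓ * M * (t - s) ≤ K * ℓ * M * h₀ := by gcongr
      linarith
    · have : K * M ^ 2 * (ε * Real.exp (L * s)) ≤ K * M ^ 2 * (ε * Real.exp L) := by gcongr
      linarith
    · have h2 : K * ℓ ^ 2 * (t - s) ≤ K * ℓ ^ 2 * h₀ := by gcongr
      have h3 : ε * 1 ≤ ε * Real.exp (L * s) := by
        gcongr; exact Real.one_le_exp (by positivity)
      linarith
  refine ⟨η 1, TransGen.head ?_ hreach, ?_⟩
  · exact ahead_add_smul (hne _) (by positivity)
  · rw [dist_comm, dist_eq_norm]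
    exact (hdisp 1 zero_le_one le_rfl).trans_lt hε₃

/-! ### Symmetry on the boundary -/

/-- Add the two variational inequalities and apply Cauchy–Schwarz. This makes projections
1-Lipschitz and, for c = c', unique. -/
lemma norm_sub_le_of_inner_nonpos {c c' v v' : E} (h : ⟪c - v, v' - v⟫ ≤ 0)
    (h' : ⟪c' - v', v - v'⟫ ≤ 0) : ‖v' - v‖ ≤ ‖c' - c‖ := by
  have e : ⟪c' - c, v' - v⟫ = ‖v' - v‖ ^ 2 - ⟪c - v, v' - v⟫ - ⟪c' - v', v - v'⟫ := by
    rw [← real_inner_self_eq_norm_sq, ← neg_sub v' v, inner_neg_right, sub_neg_eq_add,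
      ← inner_sub_left, ← inner_add_left]
    congr 1
    abel
  have h1 := real_inner_le_norm (c' - c) (v' - v)
  by_contra! hc
  nlinarith [norm_nonneg (c' - c), norm_nonneg (v' - v)]

lemma exists_projection [FiniteDimensional ℝ E] {C : Set E} (hne : C.Nonempty) (hcl : IsClosed C)
    (hc : Convex ℝ C) :
    ∃ π : E → E, ∀ c, π c ∈ C ∧ ∀ w ∈ C, ⟪c - π c, w - π c⟫ ≤ 0 := by
  have : ProperSpace E := FiniteDimensional.proper ℝ E
  choose π hπ hmin using exists_norm_eq_iInf_of_complete_convex hne hcl.isComplete hc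
  exact ⟨π, fun c => ⟨hπ c, (norm_eq_iInf_iff_real_inner_le_zero hc (hπ c)).1 (hmin c)⟩⟩

lemma mem_closure_reach_symm [FiniteDimensional ℝ E] (hF : ContDiff ℝ 1 F) (hne : ∀ x, F x ≠ 0)
    (hac : ∀ x, x ∉ reach F x) {p : E} (hp : p ∈ closure (reach F y)) (hpy : p ∉ reach F y) :
    y ∈ closure (reach F p) := by
  have : ProperSpace E := FiniteDimensional.proper ℝ E
  obtain ⟨π, hπ⟩ := exists_projection ⟨y, hac y⟩ (isOpen_reach F y).isClosed_compl
    (convex_compl_reach F y)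
  have hlip : ∀ c c', ‖π c' - π c‖ ≤ ‖c' - c‖ := fun c c' =>
    norm_sub_le_of_inner_nonpos ((hπ c).2 _ (hπ c').1) ((hπ c').2 _ (hπ c).1)
  have huniq : ∀ c v, v ∉ reach F y → (∀ w ∉ reach F y, ⟪c - v, w - v⟫ ≤ 0) → π c = v := by
    intro c v hv hvar
    have := norm_sub_le_of_inner_nonpos (hvar _ (hπ c).1) ((hπ c).2 _ hv)
    rwa [sub_self, norm_zero, norm_le_zero_iff, sub_eq_zero] at this
  have hπy : π y = y := huniq y y (hac y) (by simp)
  have hπcl : ∀ c, ReflTransGen (Ahead F) y c → π c ∈ closure (reach F y) := by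
    intro c hc
    rcases reflTransGen_iff_eq_or_transGen.1 hc with rfl | hc
    · rw [hπy]; exact mem_closure_reach_self (hne _)
    have hcv : c - π c ≠ 0 := fun h => (hπ c).1 (sub_eq_zero.1 h ▸ hc)
    have ht : Tendsto (fun t : ℝ => π c + t • (c - π c)) (𝓝[>] 0) (𝓝 (π c)) := by
      have : Tendsto (fun t : ℝ => π c + t • (c - π c)) (𝓝 0) (𝓝 (π c + (0 : ℝ) • (c - π c))) :=
        Continuous.tendsto (by fun_prop) 0
      rw [zero_smul, add_zero] at this
      exact this.mono_left nhdsWithin_le_nhds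
    refine mem_closure_of_tendsto ht ?_
    -- A point of the complement displaced from π c toward c would violate the variational
    -- inequality.
    filter_upwards [self_mem_nhdsWithin] with t (h : 0 < t)
    by_contra hmem
    have := (hπ c).2 _ hmem
    rw [add_sub_cancel_left, real_inner_smul_right] at this
    exact absurd this (not_le.2 (mul_pos h (real_inner_self_pos.2 hcv)))
  have hchain : ∀ q, ReflTransGen (Ahead F) y q → y ∈ closure (reach F (π q)) := by
    intro q hq
    induction hq with
    | refl => rw [hπy]; exact mem_closure_reach_self (hne y)
    | @tail q q' hq hqq' ih =>
      have hseg : ∀ t : ℝ, 0 ≤ t → t ≤ 1 → ReflTransGen (Ahead F) y (q' + t • (q - q')) := by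
        intro t h0 h1
        rcases h1.eq_or_lt with rfl | h1
        · simpa using hq
        · refine hq.tail ?_
          have e : q' + t • (q - q') - q = (1 - t) • (q' - q) := by module
          unfold Ahead
          rw [e, real_inner_smul_left]
          exact mul_pos (sub_pos.2 h1) hqq'
      -- The segment is run from q' back to q, so that π q is approached from π q' and the induction
      -- hypothesis applies.
      have hpath := mem_closure_reach_of_path hF hne (ζ := fun t => π (q' + t • (q - q')))
        (ℓ := ‖q - q'‖) (norm_nonneg _) ?_ ?_
      · simp only [one_smul, add_sub_cancel, zero_smul, add_zero] at hpath
        exact closure_minimal (reach_subset_of_mem_closure hF.continuous hpath |>.trans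
          subset_closure) isClosed_closure ih
      · intro s t _ hst _
        refine (hlip _ _).trans ?_
        have e : q' + t • (q - q') - (q' + s • (q - q')) = (t - s) • (q - q') := by module
        rw [e, norm_smul, Real.norm_of_nonneg (sub_nonneg.2 hst), mul_comm]
      · intro s t h0 hst h1
        have := inner_nonpos_of_mem_closure hF.continuous
          (hπcl _ (hseg t (h0.trans hst) h1)) (hπ (q' + s • (q - q'))).1
        rw [← neg_sub, inner_neg_left]
        linarith
  -- The boundary point p is not reachable from y, but p + F p is, and it projects to p because F p
  -- is normal there.
  have hπp : π (p + (1 : ℝ) • F p) = p := by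
    refine huniq _ _ hpy fun w hw => ?_
    rw [one_smul, add_sub_cancel_left, real_inner_comm]
    exact inner_nonpos_of_mem_closure hF.continuous hp hw
  have := hchain (p + (1 : ℝ) • F p) (TransGen.to_reflTransGen
    (reach_subset_of_mem_closure hF.continuous hp
      (TransGen.single (ahead_add_smul (hne p) one_pos))))
  rwa [hπp] at this

lemma exists_mem_closure_of_crossing (hxy : x ∉ reach F y) (hx : w ∈ reach F x)
    (hy : w ∈ reach F y) :
    ∃ p, ReflTransGen (Ahead F) x p ∧ p ∈ closure (reach F y) ∧ p ∉ reach F y := by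
  by_contra! hc
  have key : ∀ q, ReflTransGen (Ahead F) x q → q ∉ reach F y := by
    intro q hq
    induction hq with
    | refl => exact hxy
    | @tail q q' hq hqq' ih =>
      intro hq'
      -- Moves can be shortened, so whole segments are reachable; by connectedness one of them must
      -- meet the boundary of `reach F y`.
      have hsub : segment ℝ q q' ⊆ {p | ReflTransGen (Ahead F) x p} := by
        rintro p ⟨a, b, ha, hb, hab, rfl⟩
        rcases hb.eq_or_lt with rfl | hb
        · rw [add_zero] at hab
          simpa [hab] using hq
        · refine hq.tail ?_
          have e : a • q + b • q' - q = b • (q' - q) := by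
            rw [eq_sub_of_add_eq hab]; module
          unfold Ahead
          rw [e, real_inner_smul_left]
          exact mul_pos hb hqq'
      obtain ⟨p, -, h1, h2⟩ := (convex_segment q q').isPreconnected (reach F y)
        (closure (reach F y))ᶜ (isOpen_reach F y) isClosed_closure.isOpen_compl
        (fun p hp => by
          by_cases h : p ∈ closure (reach F y)
          · exact Or.inl (hc p (hsub hp) h)
          · exact Or.inr h)
        ⟨q', right_mem_segment ℝ q q', hq'⟩
        ⟨q, left_mem_segment ℝ q q', fun h => ih (hc q hq h)⟩
      exact h2 (subset_closure h1)
  exact key w hx.to_reflTransGen hy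

/-- Two sets of reachable points are nested as soon as they meet. -/
lemma reach_subset_or_subset [FiniteDimensional ℝ E] (hF : ContDiff ℝ 1 F) (hne : ∀ x, F x ≠ 0)
    (hac : ∀ x, x ∉ reach F x) (hx : w ∈ reach F x) (hy : w ∈ reach F y) :
    reach F x ⊆ reach F y ∨ reach F y ⊆ reach F x := by
  by_cases hxy : x ∈ reach F y
  · exact Or.inl fun v hv => TransGen.trans hxy hv
  obtain ⟨p, hxp, hp, hpy⟩ := exists_mem_closure_of_crossing hxy hx hy
  have hyp := reach_subset_of_mem_closure hF.continuous
    (mem_closure_reach_symm hF hne hac hp hpy)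
  exact Or.inr fun v hv => TransGen.trans_right hxp (hyp hv)

/-! ### The quasi-convex function -/

open scoped ENNReal in
/-- The total weight `∑ 2⁻ⁿ` of the indices `n` such that `w` is reachable from `q n`. -/
noncomputable def weight (F : E → E) (q : ℕ → E) (w : E) : ℝ≥0∞ :=
  ∑' n, (reach F (q n)).indicator (fun _ => (2⁻¹ : ℝ≥0∞) ^ n) w

lemma weight_ne_top (F : E → E) (q : ℕ → E) (w : E) : weight F q w ≠ ⊤ := by
  refine ne_top_of_le_ne_top ?_ (ENNReal.tsum_le_tsum fun n => Set.indicator_le_self _ _ _)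
  rw [ENNReal.tsum_geometric, ENNReal.one_sub_inv_two, inv_inv]
  exact ENNReal.ofNat_ne_top

lemma lowerSemicontinuous_toReal_weight (F : E → E) (q : ℕ → E) :
    LowerSemicontinuous fun w => (weight F q w).toReal := by
  have hl : LowerSemicontinuous (weight F q) := lowerSemicontinuous_tsum fun n =>
    (isOpen_reach F (q n)).lowerSemicontinuous_indicator zero_le
  intro w r hr
  rcases lt_or_ge r 0 with h0 | h0
  · exact Eventually.of_forall fun v => h0.trans_le ENNReal.toReal_nonneg
  · filter_upwards [hl w _ ((ENNReal.ofReal_lt_iff_lt_toReal h0 (weight_ne_top F q w)).2 hr)]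
      with v hv
    exact (ENNReal.ofReal_lt_iff_lt_toReal h0 (weight_ne_top F q v)).1 hv

lemma weight_le_of_imp {q : ℕ → E} {u v : E} (h : ∀ n, u ∈ reach F (q n) → v ∈ reach F (q n)) :
    weight F q u ≤ weight F q v := by
  refine ENNReal.tsum_le_tsum fun n => ?_
  by_cases hu : u ∈ reach F (q n)
  · rw [Set.indicator_of_mem hu, Set.indicator_of_mem (h n hu)]
  · rw [Set.indicator_of_notMem hu]
    exact zero_le

/-- Otherwise some reachable set contains the combination but not u, and another contains it but not
v. By convexity of complements each contains the other endpoint, contradicting nestedness. -/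
lemma weight_combo_le [FiniteDimensional ℝ E] (hF : ContDiff ℝ 1 F) (hne : ∀ x, F x ≠ 0)
    (hac : ∀ x, x ∉ reach F x)
    (q : ℕ → E) {u v : E} {a b : ℝ} (ha : 0 ≤ a) (hb : 0 ≤ b) (hab : a + b = 1) :
    weight F q (a • u + b • v) ≤ weight F q u ∨ weight F q (a • u + b • v) ≤ weight F q v := by
  by_contra! hc
  obtain ⟨n, hn, hnu⟩ : ∃ n, a • u + b • v ∈ reach F (q n) ∧ u ∉ reach F (q n) := by
    by_contra! h
    exact hc.1.not_ge (weight_le_of_imp h)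
  obtain ⟨k, hk, hkv⟩ : ∃ n, a • u + b • v ∈ reach F (q n) ∧ v ∉ reach F (q n) := by
    by_contra! h
    exact hc.2.not_ge (weight_le_of_imp h)
  have hnv := (reach_of_combo ha hb hab hn).resolve_left hnu
  have hku := (reach_of_combo ha hb hab hk).resolve_right hkv
  rcases reach_subset_or_subset hF hne hac hn hk with h | h
  · exact hkv (h hnv)
  · exact hnu (h hku)

lemma weight_lt_of_ahead (hF : Continuous F) (hne : ∀ x, F x ≠ 0) (hac : ∀ x, x ∉ reach F x)
    {q : ℕ → E} (hq : DenseRange q) (h : Ahead F x y) : weight F q x < weight F q y := by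
  have ho : IsOpen {z | Ahead F z y} := isOpen_lt continuous_const (by fun_prop)
  have hcl : x ∈ closure (reach F x) := mem_closure_reach_self (hne x)
  obtain ⟨z, hz, hxz⟩ := mem_closure_iff.1 hcl _ ho h
  -- This q n reaches y but not x: it is itself reachable from x, so reaching x would close a cycle.
  obtain ⟨n, hn, hxn⟩ := hq.exists_mem_open (ho.inter (isOpen_reach F x)) ⟨z, hz, hxz⟩
  have hxn' : x ∉ reach F (q n) := fun hx => hac x (TransGen.trans hxn hx)
  have hyn : y ∈ reach F (q n) := TransGen.single hn
  refine ENNReal.tsum_lt_tsum (i := n) (weight_ne_top F q x) (fun k => ?_) ?_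
  · by_cases hk : x ∈ reach F (q k)
    · rw [Set.indicator_of_mem hk, Set.indicator_of_mem (show y ∈ reach F (q k) from hk.tail h)]
    · rw [Set.indicator_of_notMem hk]
      exact zero_le
  · rw [Set.indicator_of_notMem hxn', Set.indicator_of_mem hyn]
    exact ENNReal.pow_pos (by simp) n

/-! ### From cycles to reachability, and the conclusion. -/

lemma exists_chain_of_transGen {α : Type*} {r : α → α → Prop} {a b : α} (h : TransGen r a b) :
    ∃ (N : ℕ) (x : ℕ → α), 1 ≤ N ∧ x 0 = a ∧ x N = b ∧ ∀ i < N, r (x i) (x (i + 1)) := by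
  induction h with
  | @single b h => exact ⟨1, fun i => if i = 0 then a else b, le_rfl, by simp, by simp, by simpa⟩
  | @tail b c _ h ih =>
    obtain ⟨N, x, hN, h0, hNb, hx⟩ := ih
    refine ⟨N + 1, fun i => if i ≤ N then x i else c, by omega, by simpa, by simp, ?_⟩
    intro i hi
    rcases (Nat.lt_succ_iff.1 hi).eq_or_lt with rfl | hi
    · simpa [hNb]
    · simpa [hi.le, Nat.succ_le_of_lt hi] using hx i hi

lemma CyclicallyQuasiMonotone.notMem_reach {d : ℕ}
    {F : EuclideanSpace ℝ (Fin d) → EuclideanSpace ℝ (Fin d)}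
    (h : CyclicallyQuasiMonotone fun x => {F x}) (x : EuclideanSpace ℝ (Fin d)) :
    x ∉ reach F x := by
  intro hx
  obtain ⟨N, c, hN, h0, hNx, hc⟩ := exists_chain_of_transGen hx
  obtain ⟨i, hi, hle⟩ := h N c (fun i => F (c i)) hN (hNx.trans h0.symm) fun _ _ => rfl
  exact hle.not_gt (hc i hi)

end QuasiMonotone

theorem theorem4 (d : ℕ) (F : EuclideanSpace ℝ (Fin d) → EuclideanSpace ℝ (Fin d))
    (hmono : QuasiMonotone.CyclicallyQuasiMonotone (fun x => {F x}))
    (hC1 : ContDiff ℝ 1 F)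
    (hne : ∀ x, F x ≠ 0) :
    ∃ f : EuclideanSpace ℝ (Fin d) → ℝ,
      LowerSemicontinuous f ∧ QuasiconvexOn ℝ Set.univ f ∧
        ∀ x, F x ∈ QuasiMonotone.normalConeMap f x := by
  have hac := hmono.notMem_reach
  have hq := TopologicalSpace.denseRange_denseSeq (EuclideanSpace ℝ (Fin d))
  set q := TopologicalSpace.denseSeq (EuclideanSpace ℝ (Fin d))
  have hmon : ∀ {u v}, QuasiMonotone.weight F q u ≤ QuasiMonotone.weight F q v →
      (QuasiMonotone.weight F q u).toReal ≤ (QuasiMonotone.weight F q v).toReal :=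
    fun h => ENNReal.toReal_mono (QuasiMonotone.weight_ne_top F q _) h
  refine ⟨fun w => (QuasiMonotone.weight F q w).toReal,
    QuasiMonotone.lowerSemicontinuous_toReal_weight F q, ?_,
    fun x => ⟨le_refl (QuasiMonotone.weight F q x).toReal, fun w hw => ?_⟩⟩
  · rintro r u ⟨-, hu⟩ v ⟨-, hv⟩ a b ha hb hab
    refine ⟨Set.mem_univ _, ?_⟩
    rcases QuasiMonotone.weight_combo_le hC1 hne hac q ha hb hab (u := u) (v := v) with h | h
    · exact (hmon h).trans hu
    · exact (hmon h).trans hv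
  · by_contra! h
    rw [real_inner_comm] at h
    have hlt := QuasiMonotone.weight_lt_of_ahead hC1.continuous hne hac hq h
    exact hw.not_gt (ENNReal.toReal_strict_mono (QuasiMonotone.weight_ne_top F q w) hlt)
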